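/- There are $n$ parking spots $1,\dots,n$ in a row and $m\le n$ cars, which enter one after the other with preferences $\alpha=(a_1,\dots,a_m)$ chosen uniformly at random from $[n]^m$, where $[n]=\{1,\dots,n\}$. Let $p\in[0,1]$. A car whose preferred spot is free parks there. Otherwise it tosses a coin (independent of the preferences and of the other coins): with probability $p$ it moves forward and takes the first free spot after its preferred one, and with probability $1-p$ it moves backward and takes the last free spot before its preferred one; if there is no such spot it fails to park. Write $\alpha\in\mathrm{PF}_{m,n}$ for the event that all $m$ cars park, and let $$Q_{m,n,p}(j)=\mathbb P\big(a_m=j\mid \alpha\in\mathrm{PF}_{m,n}\big),\qquad j\in[n],$$ be the conditional distribution of the preference of the last car. Let $\mathrm{Uni}_n$ be the uniform distribution on $[n]$ and $\|P-Q\|_{\mathrm{TV}}=\frac12\sum_{j=1}^n|P(j)-Q(j)|$. Proposition. Let $0<c<1$ and let $m=m(n)$ be $cn$ up to rounding, that is, let $m(n)$ be nonnegative integers with $|m(n)-cn|<1$ for all $n$ (so $m(n)=cn$ whenever $cn$ is an integer). Then for every $p\in[0,1]$, $$\|Q_{m(n),n,p}-\mathrm{Uni}_n\|_{\mathrm{TV}}=\Theta\left(\frac1n\right)\qquad(n\to\infty),$$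 that is, there are constants $0<C_1\le C_2$ and $N$ (which may depend on $c$ and $p$) such that $C_1/n\le\|Q_{m(n),n,p}-\mathrm{Uni}_n\|_{\mathrm{TV}}\le C_2/n$ for all $n\ge N$. -/

import Mathlib

namespace ProbParking

/-- The spot taken by a car with preferred spot `a` when the set of occupied spots is `S`
(`none` if the car fails to park). The spots `1, …, n` are modelled by `Fin n`.
If `a` is free, the car parks there. Otherwise its coin decides: on heads (`true`) it moves forward
to the first free spot after `a`, on tails (`false`) it moves backward to the last free spot
before `a`. -/
def parkSpot {n : ℕ} (S : Finset (Fin n)) (a : Fin n) (coin : Bool) : Option (Fin n) :=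
  if a ∉ S then some a
  else if coin then
    if h : (Finset.univ.filter fun k => a < k ∧ k ∉ S).Nonempty then
      some ((Finset.univ.filter fun k => a < k ∧ k ∉ S).min' h)
    else none
  else
    if h : (Finset.univ.filter fun k => k < a ∧ k ∉ S).Nonempty then
      some ((Finset.univ.filter fun k => k < a ∧ k ∉ S).max' h)
    else none

/-- The set of occupied spots after `m` cars with preferences `a` and coins `b` have entered the
street one after the other, starting from an empty street; `none` if some car failed to park. -/
def occupied {n : ℕ} : (m : ℕ) → (Fin m → Fin n) → (Fin m → Bool) → Option (Finset (Fin n))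
  | 0, _, _ => some ∅
  | m + 1, a, b =>
    (occupied m (Fin.init a) (Fin.init b)).bind fun S =>
      (parkSpot S (a (Fin.last m)) (b (Fin.last m))).map fun k => insert k S

/-- The event `α ∈ PF_{m,n}`: all `m` cars park. -/
def AllPark {m n : ℕ} (a : Fin m → Fin n) (b : Fin m → Bool) : Prop :=
  (occupied m a b).isSome = true

open Classical in
/-- The probability of the event `E` when the preference list `a` is uniform on `[n]^m` and,
independently of it, the coins `b` of the `m` cars are independent, each showing heads with
probability `p`. -/
noncomputable def prob (p : ℝ) (m n : ℕ) (E : (Fin m → Fin n) → (Fin m → Bool) → Prop) : ℝ :=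
  ∑ a : Fin m → Fin n, ∑ b : Fin m → Bool,
    if E a b then (1 / (n : ℝ) ^ m) * ∏ i, (if b i then p else 1 - p) else 0

/-- The event `a_m = j`: the last of the `m` cars prefers spot `j`. -/
def LastPref {m n : ℕ} (j : Fin n) (a : Fin m → Fin n) : Prop :=
  ∃ i : Fin m, (i : ℕ) + 1 = m ∧ a i = j

/-- `Q_{m,n,p}(j) = ℙ(a_m = j | α ∈ PF_{m,n})`. -/
noncomputable def Q (m n : ℕ) (p : ℝ) (j : Fin n) : ℝ :=
  prob p m n (fun a b => LastPref j a ∧ AllPark a b) / prob p m n (fun a b => AllPark a b)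

/-- The uniform distribution on `[n]`. -/
noncomputable def Uni (n : ℕ) (_ : Fin n) : ℝ := 1 / (n : ℝ)

/-- Total variation distance of two distributions on `[n]`. -/
noncomputable def tv {n : ℕ} (P R : Fin n → ℝ) : ℝ := (1 / 2) * ∑ j, |P j - R j|

end ProbParking

/-! Put `k = m - 1`. Let `W` be the coin-weighted number of ways in which the first `k` cars park,
`d j` the part of it after which a car preferring `j` fails, and `D` the sum of the `d j`. Then `Q j
= (W - d j) / (n * W - D)` (`Q_succ_eq`), so the distance to uniform is `∑ |D - n * d j| / (2 * n *
(n * W - D))` and only the sizes of `W`, `D` and `d` matter.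

A car preferring `j` fails on heads iff all spots from `j` on are occupied, on tails iff all spots
up to `j` are. Thus `D` is governed by the mean lengths of the occupied runs at the two ends. To
compute, close the street to a circle with one additional spot (Pollak's argument). There every car
parks, and by rotation invariance each spot is occupied with probability `k / (n + 1)`; the street
is the event that the additional spot stays empty. This gives `W` exactly, for every `p`
(`expect_parkSpot_one`). Runs at the ends of the street become runs next to an empty spot of the
circle, and rotating their far ends to one fixed spot makes the events disjoint, so `D ≤ (n + 1) ^ k
* (k / (n + 1))` (`sum_defect_le`).

Upper bound: the distance is at most `D / (n * W - D) ≤ 1 / (n - k)`. Lower bound: an end spot stays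
free iff the cars park in the street without it, so its occupation weight is a difference of two
values of `W`, the same at both ends. Since the coin weights add to 1, the defects of the two end
spots together are at least a constant fraction of `W`, whereas the average defect `D / n` is only
`O(W / n)`. These two spots alone contribute order `1 / n`. -/

namespace ProbParking

/-! ### Parking processes with a general spot function -/

section SpotFunction

variable {A B : Type*} [Fintype A] [DecidableEq A] [Fintype B] [DecidableEq B]

/-- The probability that a coin shows `c`. -/
def coinWeight (p : ℝ) (c : Bool) : ℝ := if c then p else 1 - p

lemma coinWeight_nonneg {p : ℝ} (hp : p ∈ Set.Icc (0 : ℝ) 1) (c : Bool) : 0 ≤ coinWeight p c := by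
  cases c <;> simp [coinWeight, hp.1, hp.2]

lemma sum_coinWeight (p : ℝ) : ∑ c, coinWeight p c = 1 := by
  simp [coinWeight]

/-- The unnormalised transition operator of a parking process with spot function `f`: the
preference is summed over all spots, the coin is averaged, and failing to park counts as `0`. -/
def step (p : ℝ) (f : Finset A → A → Bool → Option A) : (Finset A → ℝ) →ₗ[ℝ] (Finset A → ℝ) where
  toFun g S := ∑ a, ∑ c, coinWeight p c * (f S a c).elim 0 fun x => g (insert x S)
  map_add' g h := by
    funext S
    simp only [Pi.add_apply, ← Finset.sum_add_distrib, ← mul_add]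
    refine Finset.sum_congr rfl fun a _ => Finset.sum_congr rfl fun c _ => ?_
    cases f S a c <;> simp
  map_smul' r g := by
    funext S
    simp only [Pi.smul_apply, Finset.smul_sum, RingHom.id_apply]
    refine Finset.sum_congr rfl fun a _ => Finset.sum_congr rfl fun c _ => ?_
    cases f S a c <;> simp [mul_left_comm]

lemma step_apply (p : ℝ) (f : Finset A → A → Bool → Option A) (g : Finset A → ℝ) (S : Finset A) :
    step p f g S = ∑ a, ∑ c, coinWeight p c * (f S a c).elim 0 fun x => g (insert x S) := rfl

/-- The unnormalised expectation of a function of the occupied set after `k` cars. -/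
def expect (p : ℝ) (f : Finset A → A → Bool → Option A) (k : ℕ) : (Finset A → ℝ) →ₗ[ℝ] ℝ :=
  LinearMap.proj ∅ ∘ₗ (step p f) ^ k

lemma expect_zero (p : ℝ) (f : Finset A → A → Bool → Option A) (g : Finset A → ℝ) :
    expect p f 0 g = g ∅ := rfl

lemma expect_succ (p : ℝ) (f : Finset A → A → Bool → Option A) (k : ℕ) (g : Finset A → ℝ) :
    expect p f (k + 1) g = expect p f k (step p f g) := by
  simp [expect, pow_succ]

lemma step_mono {p : ℝ} (hp : p ∈ Set.Icc (0 : ℝ) 1) (f : Finset A → A → Bool → Option A)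
    {g h : Finset A → ℝ} (hgh : g ≤ h) : step p f g ≤ step p f h := by
  intro S
  refine Finset.sum_le_sum fun a _ => Finset.sum_le_sum fun c _ =>
    mul_le_mul_of_nonneg_left ?_ (coinWeight_nonneg hp c)
  cases f S a c
  · simp
  · exact hgh _

lemma expect_mono {p : ℝ} (hp : p ∈ Set.Icc (0 : ℝ) 1) (f : Finset A → A → Bool → Option A)
    (k : ℕ) {g h : Finset A → ℝ} (hgh : g ≤ h) : expect p f k g ≤ expect p f k h := by
  induction k generalizing g h with
  | zero => exact hgh _
  | succ k ih => rw [expect_succ, expect_succ]; exact ih (step_mono hp f hgh)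

open Classical in
/-- The indicator function of a property of the occupied set. -/
noncomputable def ind (P : Finset A → Prop) (S : Finset A) : ℝ := if P S then 1 else 0

omit [Fintype A] [DecidableEq A] in
lemma ind_pos {P : Finset A → Prop} {S : Finset A} (h : P S) : ind P S = 1 := if_pos h

omit [Fintype A] [DecidableEq A] in
lemma ind_neg {P : Finset A → Prop} {S : Finset A} (h : ¬ P S) : ind P S = 0 := if_neg h

omit [Fintype A] [DecidableEq A] in
lemma ind_nonneg (P : Finset A → Prop) : 0 ≤ ind P := by
  intro S
  unfold ind
  split_ifs <;> simp

omit [Fintype A] [DecidableEq A] in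
lemma sum_ind {J : Type*} [Fintype J] (P : J → Finset A → Prop) (S : Finset A) :
    ∑ j, ind (P j) S = ({j | P j S} : Set J).ncard := by
  classical
  simp only [ind]
  rw [Finset.sum_boole, ← Set.ncard_coe_finset]
  simp

omit [Fintype A] [DecidableEq A] in
lemma ind_le_ind {P R : Finset A → Prop} (h : ∀ S, P S → R S) : ind P ≤ ind R := by
  intro S
  by_cases hP : P S
  · rw [ind_pos hP, ind_pos (h S hP)]
  · rw [ind_neg hP]; exact ind_nonneg R S

open Classical in
/-- Extension by zero, along an embedding of the spots, of a function of the occupied set. -/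
noncomputable def extendZero (e : B ↪ A) (g : Finset B → ℝ) (S : Finset A) : ℝ :=
  if ∃ T : Finset B, T.map e = S then g (S.preimage e e.injective.injOn) else 0

omit [Fintype A] [DecidableEq B] in
lemma extendZero_map (e : B ↪ A) (g : Finset B → ℝ) (T : Finset B) :
    extendZero e g (T.map e) = g T := by
  rw [extendZero, if_pos ⟨T, rfl⟩, Finset.preimage_map]

omit [Fintype A] [DecidableEq B] in
lemma extendZero_of_mem (e : B ↪ A) (g : Finset B → ℝ) {S : Finset A} {x : A} (hx : x ∈ S)
    (hxe : x ∉ Set.range e) : extendZero e g S = 0 := by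
  rw [extendZero, if_neg]
  rintro ⟨T, rfl⟩
  obtain ⟨y, -, rfl⟩ := Finset.mem_map.1 hx
  exact hxe ⟨y, rfl⟩

omit [Fintype A] [DecidableEq B] in
lemma exists_map_eq_or (e : B ↪ A) (S : Finset A) :
    (∃ T : Finset B, T.map e = S) ∨ ∃ x ∈ S, x ∉ Set.range e := by
  by_cases h : ∃ x ∈ S, x ∉ Set.range e
  · exact Or.inr h
  · push Not at h
    refine Or.inl ⟨S.preimage e e.injective.injOn, ?_⟩
    ext x
    simp only [Finset.mem_map, Finset.mem_preimage]
    constructor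
    · rintro ⟨y, hy, rfl⟩; exact hy
    · intro hx
      obtain ⟨y, rfl⟩ := h x hx
      exact ⟨y, hx, rfl⟩

/-- If the process with spot function `f'` is the process with spot function `f` restricted to a
subset of the spots, where parking outside of this subset counts as failing, then its expectations
are those of `f` on the event that all occupied spots lie in the subset. -/
theorem expect_extendZero (p : ℝ) (e : B ↪ A) {f : Finset A → A → Bool → Option A}
    {f' : Finset B → B → Bool → Option B} (hfree : ∀ S a c, a ∉ S → f S a c = some a)
    (hsome : ∀ T b c x, f' T b c = some x → f (T.map e) (e b) c = some (e x))
    (hnone : ∀ T b c y, f' T b c = none → f (T.map e) (e b) c = some y → y ∉ Set.range e)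
    (k : ℕ) (g : Finset B → ℝ) : expect p f k (extendZero e g) = expect p f' k g := by
  -- Extension by zero intertwines the two transition operators.
  have key : ∀ g, step p f (extendZero e g) = extendZero e (step p f' g) := by
    intro g
    funext S
    rcases exists_map_eq_or e S with ⟨T, rfl⟩ | ⟨x, hx, hxe⟩
    · rw [extendZero_map, step_apply, step_apply]
      -- A preference outside the image is a free spot, so the car parks there and the extension
      -- vanishes.
      refine (Finset.sum_of_injOn e e.injective.injOn (fun _ _ => Finset.mem_univ _) ?_ ?_).symm
      · intro a _ ha
        simp only [Finset.coe_univ, Set.image_univ] at ha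
        refine Finset.sum_eq_zero fun c _ => ?_
        have haT : a ∉ T.map e := fun h => by
          obtain ⟨y, -, rfl⟩ := Finset.mem_map.1 h
          exact ha ⟨y, rfl⟩
        rw [hfree _ _ _ haT, Option.elim_some,
          extendZero_of_mem e g (Finset.mem_insert_self _ _) ha, mul_zero]
      · intro b _
        refine Finset.sum_congr rfl fun c _ => ?_
        congr 1
        cases h' : f' T b c with
        | some x =>
          rw [hsome _ _ _ _ h', Option.elim_some, Option.elim_some, ← Finset.map_insert,
            extendZero_map]
        | none =>
          cases h : f (T.map e) (e b) c with
          | none => rfl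
          | some y =>
            rw [Option.elim_none, Option.elim_some,
              extendZero_of_mem e g (Finset.mem_insert_self _ _) (hnone _ _ _ _ h' h)]
    -- A spot outside the image, once occupied, stays occupied.
    · rw [extendZero_of_mem e _ hx hxe, step_apply]
      refine Finset.sum_eq_zero fun a _ => Finset.sum_eq_zero fun c _ => ?_
      cases f S a c with
      | none => simp
      | some y =>
        rw [Option.elim_some, extendZero_of_mem e g (Finset.mem_insert_of_mem hx) hxe, mul_zero]
  induction k generalizing g with
  | zero => exact extendZero_map e g ∅
  | succ k ih => rw [expect_succ, expect_succ, key, ih]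

end SpotFunction

/-! ### Parking on a circle and rotation invariance -/

section Circle

variable {A : Type*} [AddCommGroup A] [Fintype A] [DecidableEq A]

/-- The first free spot among `a, a + u, a + 2u, …`. -/
noncomputable def advance (u : A) (S : Finset A) (a : A) : A := a + sInf {i : ℕ | a + i • u ∉ S} • u

omit [Fintype A] [DecidableEq A] in
lemma advance_eq {u : A} {S : Finset A} {a : A} {i : ℕ} (hi : a + i • u ∉ S)
    (hlt : ∀ l < i, a + l • u ∈ S) : advance u S a = a + i • u := by
  have : sInf {i : ℕ | a + i • u ∉ S} = i :=
    le_antisymm (Nat.sInf_le hi) (le_csInf ⟨i, hi⟩ fun l hl => not_lt.1 fun h => hl (hlt l h))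
  rw [advance, this]

/-- Since `u` generates the group, the search reaches every spot. A full circle must be excluded:
there `sInf ∅ = 0` makes `advance` return the occupied spot `a`. -/
lemma advance_notMem {u : A} (hu : ∀ x : A, ∃ i : ℕ, i • u = x) {S : Finset A}
    (hS : S ≠ Finset.univ) (a : A) : advance u S a ∉ S := by
  obtain ⟨x, hx⟩ : ∃ x, x ∉ S := by
    by_contra! h
    exact hS (Finset.eq_univ_iff_forall.2 h)
  obtain ⟨i, hi⟩ := hu (x - a)
  exact Nat.sInf_mem (s := {i : ℕ | a + i • u ∉ S}) ⟨i, by simpa [hi] using hx⟩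

/-- Parking on a circle: heads moves by `u` and tails by `-u` until a free spot is found. -/
noncomputable def circleSpot (u : A) (S : Finset A) (a : A) (c : Bool) : Option A :=
  some (advance (if c then u else -u) S a)

omit [Fintype A] [DecidableEq A] in
lemma circleSpot_of_notMem (u : A) (S : Finset A) (a : A) (c : Bool) (h : a ∉ S) :
    circleSpot u S a c = some a := by
  rw [circleSpot, advance_eq (i := 0) (by simpa using h) (by simp)]
  simp

/-- The rotation of a set of spots by `r`. -/
def rotate (r : A) (S : Finset A) : Finset A := S.map (Equiv.addRight r).toEmbedding

omit [Fintype A] [DecidableEq A] in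
lemma mem_rotate {r x : A} {S : Finset A} : x ∈ rotate r S ↔ x - r ∈ S := by
  simp [rotate, sub_eq_add_neg]

omit [Fintype A] in
lemma rotate_insert (r x : A) (S : Finset A) :
    rotate r (insert x S) = insert (x + r) (rotate r S) := by
  simp [rotate, Finset.map_insert]

omit [Fintype A] [DecidableEq A] in
lemma advance_rotate (u r : A) (S : Finset A) (a : A) :
    advance u (rotate r S) (a + r) = advance u S a + r := by
  have : ∀ i : ℕ, a + r + i • u ∈ rotate r S ↔ a + i • u ∈ S := fun i => by
    rw [mem_rotate]
    congr! 1
    abel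
  simp only [advance, this]
  abel

/-- Preferences are summed over the whole group, parking commutes with translation, and the empty
initial set is invariant. -/
lemma expect_rotate (p : ℝ) (u r : A) (k : ℕ) (g : Finset A → ℝ) :
    expect p (circleSpot u) k (fun S => g (rotate r S)) = expect p (circleSpot u) k g := by
  have key : ∀ g : Finset A → ℝ, step p (circleSpot u) (fun S => g (rotate r S)) =
      fun S => step p (circleSpot u) g (rotate r S) := by
    intro g
    funext S
    rw [step_apply, step_apply]
    refine Fintype.sum_equiv (Equiv.addRight r) _ _ fun a => ?_
    simp [circleSpot, advance_rotate, rotate_insert]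
  induction k generalizing g with
  | zero => simp [expect_zero, rotate]
  | succ k ih => rw [expect_succ, expect_succ, key, ih]

lemma expect_circle_one (p : ℝ) (u : A) (k : ℕ) :
    expect p (circleSpot u) k 1 = (Fintype.card A : ℝ) ^ k := by
  have key : step p (circleSpot u) 1 = (Fintype.card A : ℝ) • (1 : Finset A → ℝ) := by
    funext S
    simp only [step_apply, circleSpot, Option.elim_some, Pi.one_apply, mul_one, sum_coinWeight]
    simp
  induction k with
  | zero => simp [expect_zero]
  | succ k ih => rw [expect_succ, key, map_smul, ih, smul_eq_mul, pow_succ']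

/-- Each car takes a free spot as long as there is one, so only sets of exactly `k` spots are
reached. -/
lemma expect_circle_congr (p : ℝ) {u : A} (hu : ∀ x : A, ∃ i : ℕ, i • u = x) {k : ℕ}
    (hk : k ≤ Fintype.card A) {g h : Finset A → ℝ} (hgh : ∀ S, S.card = k → g S = h S) :
    expect p (circleSpot u) k g = expect p (circleSpot u) k h := by
  have hu' : ∀ x : A, ∃ i : ℕ, i • (-u) = x := fun x => by
    obtain ⟨i, hi⟩ := hu (-x)
    exact ⟨i, by rw [smul_neg, hi, neg_neg]⟩
  induction k generalizing g h with
  | zero => exact hgh _ rfl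
  | succ k ih =>
    rw [expect_succ, expect_succ]
    refine ih (by omega) fun S hS => ?_
    have hne : S ≠ Finset.univ := by
      rintro rfl
      rw [Finset.card_univ] at hS
      omega
    refine Finset.sum_congr rfl fun a _ => Finset.sum_congr rfl fun c _ => ?_
    congr 1
    refine hgh _ ?_
    rw [Finset.card_insert_of_notMem, hS]
    cases c
    · exact advance_notMem hu' hne a
    · exact advance_notMem hu hne a

/-- After `k` cars, every spot of the circle is occupied with probability `k / N`. -/
lemma expect_circle_mem (p : ℝ) {u : A} (hu : ∀ x : A, ∃ i : ℕ, i • u = x) {k : ℕ}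
    (hk : k ≤ Fintype.card A) :
    expect p (circleSpot u) k (ind fun S => (0 : A) ∈ S) =
      (Fintype.card A : ℝ) ^ k * k / Fintype.card A := by
  have h1 : ∀ x : A, expect p (circleSpot u) k (ind fun S => x ∈ S) =
      expect p (circleSpot u) k (ind fun S => (0 : A) ∈ S) := fun x => by
    rw [← expect_rotate p u x]
    congr 1
    funext S
    simp [ind, mem_rotate]
  have h2 : ∑ x : A, expect p (circleSpot u) k (ind fun S => x ∈ S) =
      (Fintype.card A : ℝ) ^ k * k := by
    rw [← map_sum, expect_circle_congr p hu hk (h := (k : ℝ) • 1), map_smul, expect_circle_one,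
      smul_eq_mul, mul_comm]
    intro S hS
    rw [Finset.sum_apply, sum_ind]
    simp [← hS, ← Set.ncard_coe_finset]
  have hA : (Fintype.card A : ℝ) ≠ 0 := Nat.cast_ne_zero.2 Fintype.card_ne_zero
  rw [eq_div_iff hA, ← h2]
  simp [h1, mul_comm]

/-- The lengths of the occupied run next to a given free spot of the circle, on average. -/
lemma sum_expect_run_le {p : ℝ} (hp : p ∈ Set.Icc (0 : ℝ) 1) (u v : A) (k : ℕ) {J : Type*}
    [Fintype J] (δ : J → ℕ) (hδ : Function.Injective δ) (hδ1 : ∀ j, 1 ≤ δ j) :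
    ∑ j, expect p (circleSpot u) k
        (ind fun S => (0 : A) ∉ S ∧ ∀ i : ℕ, 1 ≤ i → i ≤ δ j → i • v ∈ S) ≤
      expect p (circleSpot u) k (ind fun S => (0 : A) ∈ S) := by
  -- Rotate the far end of the run to `0`; the free spot moves to `-(δ j • v)`.
  have h1 : ∀ j, expect p (circleSpot u) k
        (ind fun S => (0 : A) ∉ S ∧ ∀ i : ℕ, 1 ≤ i → i ≤ δ j → i • v ∈ S) ≤
      expect p (circleSpot u) k
        (ind fun S => -(δ j • v) ∉ S ∧ ∀ l < δ j, -(l • v) ∈ S) := fun j => by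
    rw [← expect_rotate p u (δ j • v)]
    refine expect_mono hp _ _ ?_
    refine ind_le_ind (P := fun S => _) fun S hS => ?_
    simp only [mem_rotate, zero_sub] at hS
    refine ⟨hS.1, fun l hl => ?_⟩
    have := hS.2 (δ j - l) (by omega) (by omega)
    rwa [sub_nsmul _ hl.le, add_sub_right_comm, sub_self, zero_add] at this
  refine (Finset.sum_le_sum fun j _ => h1 j).trans ?_
  rw [← map_sum]
  refine expect_mono hp _ _ fun S => ?_
  rw [Finset.sum_apply]
  -- If `0` is occupied, `δ j` must be the distance to the first free spot in direction `-v`, so at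
  -- most one `j` counts. If `0` is free, no `j` counts, because `l = 0` is below `δ j`.
  by_cases h0 : (0 : A) ∈ S
  · rw [ind_pos h0]
    rw [sum_ind, Nat.cast_le_one, Set.ncard_le_one]
    intro j hj j' hj'
    refine hδ (le_antisymm ?_ ?_)
    · exact not_lt.1 fun h => hj'.1 (hj.2 _ h)
    · exact not_lt.1 fun h => hj.1 (hj'.2 _ h)
  · rw [ind_neg h0]
    refine (Finset.sum_eq_zero fun j _ => ind_neg fun hj => h0 ?_).le
    simpa using hj.2 0 (hδ1 j)

end Circle

/-! ### The street as a circle with an additional empty spot -/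

section Line

variable {n : ℕ}

lemma parkSpot_true_eq_some_iff {S : Finset (Fin n)} {a x : Fin n} :
    parkSpot S a true = some x ↔ a ≤ x ∧ x ∉ S ∧ ∀ y, a ≤ y → y < x → y ∈ S := by
  unfold parkSpot
  by_cases ha : a ∈ S
  · rw [if_neg (not_not.2 ha), if_pos rfl]
    split_ifs with h
    · rw [Option.some_inj]
      have hm := Finset.min'_mem _ h
      simp only [Finset.mem_filter, Finset.mem_univ, true_and] at hm
      constructor
      · rintro rfl
        refine ⟨hm.1.le, hm.2, fun y hay hy => ?_⟩
        by_contra hyS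
        have hne : a ≠ y := by rintro rfl; exact hyS ha
        exact not_le.2 hy (Finset.min'_le _ _ (by simp [hyS, lt_of_le_of_ne hay hne]))
      · rintro ⟨hax, hx, hlt⟩
        have hne : a ≠ x := by rintro rfl; exact hx ha
        refine le_antisymm (Finset.min'_le _ _ (by simp [hx, lt_of_le_of_ne hax hne])) ?_
        exact not_lt.1 fun h' => hm.2 (hlt _ hm.1.le h')
    · refine iff_of_false (by simp) ?_
      rintro ⟨hax, hx, -⟩
      have hne : a ≠ x := by rintro rfl; exact hx ha
      exact h ⟨x, by simp [hx, lt_of_le_of_ne hax hne]⟩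
  · rw [if_pos ha, Option.some_inj]
    constructor
    · rintro rfl
      exact ⟨le_rfl, ha, fun y h h' => absurd h (not_le.2 h')⟩
    · rintro ⟨hax, hx, hlt⟩
      exact eq_of_le_of_not_lt hax fun h => ha (hlt a le_rfl h)

lemma parkSpot_false_eq_some_iff {S : Finset (Fin n)} {a x : Fin n} :
    parkSpot S a false = some x ↔ x ≤ a ∧ x ∉ S ∧ ∀ y, x < y → y ≤ a → y ∈ S := by
  unfold parkSpot
  by_cases ha : a ∈ S
  · rw [if_neg (not_not.2 ha), if_neg Bool.false_ne_true]
    split_ifs with h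
    · rw [Option.some_inj]
      have hm := Finset.max'_mem _ h
      simp only [Finset.mem_filter, Finset.mem_univ, true_and] at hm
      constructor
      · rintro rfl
        refine ⟨hm.1.le, hm.2, fun y hy hay => ?_⟩
        by_contra hyS
        have hne : y ≠ a := by rintro rfl; exact hyS ha
        exact not_le.2 hy (Finset.le_max' _ _ (by simp [hyS, lt_of_le_of_ne hay hne]))
      · rintro ⟨hax, hx, hlt⟩
        have hne : x ≠ a := by rintro rfl; exact hx ha
        refine le_antisymm ?_ (Finset.le_max' _ _ (by simp [hx, lt_of_le_of_ne hax hne]))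
        exact not_lt.1 fun h' => hm.2 (hlt _ h' hm.1.le)
    · refine iff_of_false (by simp) ?_
      rintro ⟨hax, hx, -⟩
      have hne : x ≠ a := by rintro rfl; exact hx ha
      exact h ⟨x, by simp [hx, lt_of_le_of_ne hax hne]⟩
  · rw [if_pos ha, Option.some_inj]
    constructor
    · rintro rfl
      exact ⟨le_rfl, ha, fun y h h' => absurd h (not_lt.2 h')⟩
    · rintro ⟨hax, hx, hlt⟩
      exact (eq_of_le_of_not_lt hax fun h => ha (hlt a h le_rfl)).symm

lemma parkSpot_true_eq_none_iff {S : Finset (Fin n)} {a : Fin n} :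
    parkSpot S a true = none ↔ ∀ y, a ≤ y → y ∈ S := by
  constructor
  · intro h y
    induction y using WellFoundedLT.induction with
    | ind y ih =>
      intro hay
      by_contra hy
      have := parkSpot_true_eq_some_iff.2 ⟨hay, hy, fun z haz hz => ih z hz haz⟩
      rw [h] at this
      cases this
  · intro h
    rw [Option.eq_none_iff_forall_ne_some]
    intro x hx
    obtain ⟨hax, hxS, -⟩ := parkSpot_true_eq_some_iff.1 hx
    exact hxS (h x hax)

lemma parkSpot_false_eq_none_iff {S : Finset (Fin n)} {a : Fin n} :
    parkSpot S a false = none ↔ ∀ y, y ≤ a → y ∈ S := by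
  constructor
  · intro h y
    induction y using WellFoundedGT.induction with
    | ind y ih =>
      intro hay
      by_contra hy
      have := parkSpot_false_eq_some_iff.2 ⟨hay, hy, fun z hz haz => ih z hz haz⟩
      rw [h] at this
      cases this
  · intro h
    rw [Option.eq_none_iff_forall_ne_some]
    intro x hx
    obtain ⟨hax, hxS, -⟩ := parkSpot_false_eq_some_iff.1 hx
    exact hxS (h x hax)

lemma parkSpot_of_notMem (S : Finset (Fin n)) (a : Fin n) (c : Bool) (h : a ∉ S) :
    parkSpot S a c = some a := if_pos h

/-- Parking in a street restricted to an interval of the street. -/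
lemma expect_parkSpot_extendZero (p : ℝ) {n' : ℕ} (e : Fin n' ↪o Fin n)
    (he : (Set.range e).OrdConnected) (k : ℕ) (g : Finset (Fin n') → ℝ) :
    expect p parkSpot k (extendZero e.toEmbedding g) = expect p parkSpot k g := by
  refine expect_extendZero p e.toEmbedding parkSpot_of_notMem ?_ ?_ k g
  · rintro T b (_ | _) x h
    · rw [parkSpot_false_eq_some_iff] at h ⊢
      refine ⟨e.le_iff_le.2 h.1, by simpa using h.2.1, fun y hxy hyb => ?_⟩
      obtain ⟨z, rfl⟩ := he.out ⟨x, rfl⟩ ⟨b, rfl⟩ ⟨hxy.le, hyb⟩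
      simpa using h.2.2 z (e.lt_iff_lt.1 hxy) (e.le_iff_le.1 hyb)
    · rw [parkSpot_true_eq_some_iff] at h ⊢
      refine ⟨e.le_iff_le.2 h.1, by simpa using h.2.1, fun y hby hyx => ?_⟩
      obtain ⟨z, rfl⟩ := he.out ⟨b, rfl⟩ ⟨x, rfl⟩ ⟨hby, hyx.le⟩
      simpa using h.2.2 z (e.le_iff_le.1 hby) (e.lt_iff_lt.1 hyx)
  · rintro T b (_ | _) y h h' ⟨z, rfl⟩
    · rw [parkSpot_false_eq_none_iff] at h
      rw [parkSpot_false_eq_some_iff] at h'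
      exact h'.2.1 (by simpa using h z (e.le_iff_le.1 h'.1))
    · rw [parkSpot_true_eq_none_iff] at h
      rw [parkSpot_true_eq_some_iff] at h'
      exact h'.2.1 (by simpa using h z (e.le_iff_le.1 h'.1))

lemma fin_val_nsmul_one (i : ℕ) : ((i • (1 : Fin (n + 1)) : Fin (n + 1)) : ℕ) = i % (n + 1) := by
  induction i with
  | zero => simp
  | succ i ih =>
    rw [succ_nsmul, Fin.val_add, ih, Fin.val_one']
    simp

lemma fin_add_nsmul_one_eq {a x : Fin (n + 1)} {i : ℕ}
    (h : (a : ℕ) + i = x ∨ (a : ℕ) + i = x + (n + 1)) : a + i • 1 = x := by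
  apply Fin.ext
  rw [Fin.val_add, fin_val_nsmul_one, Nat.add_mod_mod]
  rcases h with h | h
  · rw [h, Nat.mod_eq_of_lt x.2]
  · rw [h, Nat.add_mod_right, Nat.mod_eq_of_lt x.2]

lemma fin_add_nsmul_neg_one_eq {a x : Fin (n + 1)} {i : ℕ} (h : (x : ℕ) + i = a) :
    a + i • (-1) = x := by
  rw [← fin_add_nsmul_one_eq (Or.inl h), smul_neg, add_neg_cancel_right]

lemma fin_exists_nsmul_one_eq (x : Fin (n + 1)) : ∃ i : ℕ, i • (1 : Fin (n + 1)) = x :=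
  ⟨x, by simpa using fin_add_nsmul_one_eq (a := 0) (x := x) (i := x) (by simp)⟩

/-- Parking in a street is parking on a circle with one additional spot that stays empty. -/
lemma expect_circle_extendZero (p : ℝ) (k : ℕ) (g : Finset (Fin n) → ℝ) :
    expect p (circleSpot (1 : Fin (n + 1))) k (extendZero (Fin.succEmb n) g) =
      expect p parkSpot k g := by
  have hmem : ∀ (T : Finset (Fin n)) (x : Fin n), x.succ ∈ T.map (Fin.succEmb n) ↔ x ∈ T :=
    fun T x => Finset.mem_map' (Fin.succEmb n)
  have h0 : ∀ T : Finset (Fin n), (0 : Fin (n + 1)) ∉ T.map (Fin.succEmb n) := fun T h => by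
    obtain ⟨y, -, hy⟩ := Finset.mem_map.1 h
    exact Fin.succ_ne_zero y hy
  refine expect_extendZero p _ (circleSpot_of_notMem _) ?_ ?_ k g
  · rintro T b (_ | _) x h
    · rw [parkSpot_false_eq_some_iff] at h
      obtain ⟨hxb, hx, hlt⟩ := h
      have hx' : b.succ + ((b : ℕ) - x) • (-1) = x.succ :=
        fin_add_nsmul_neg_one_eq (by simp; omega)
      have := advance_eq (u := -1) (S := T.map (Fin.succEmb n)) (a := b.succ) (i := (b : ℕ) - x)
        (by rwa [hx', hmem]) fun l hl => by
          rw [fin_add_nsmul_neg_one_eq (x := (⟨b - l, by omega⟩ : Fin n).succ)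
            (by simp; omega), hmem]
          exact hlt _ (Fin.lt_def.2 (by simp; omega)) (Fin.le_def.2 (by simp))
      exact congrArg some (this.trans hx')
    · rw [parkSpot_true_eq_some_iff] at h
      obtain ⟨hxb, hx, hlt⟩ := h
      have hx' : b.succ + ((x : ℕ) - b) • 1 = x.succ :=
        fin_add_nsmul_one_eq (Or.inl (by simp; omega))
      have := advance_eq (u := 1) (S := T.map (Fin.succEmb n)) (a := b.succ) (i := (x : ℕ) - b)
        (by rwa [hx', hmem]) fun l hl => by
          rw [fin_add_nsmul_one_eq (x := (⟨b + l, by omega⟩ : Fin n).succ)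
            (Or.inl (by simp; omega)), hmem]
          exact hlt _ (Fin.le_def.2 (by simp)) (Fin.lt_def.2 (by simp; omega))
      exact congrArg some (this.trans hx')
  · rintro T b (_ | _) y h h' ⟨z, rfl⟩
    · rw [parkSpot_false_eq_none_iff] at h
      -- A car that would leave the street backward reaches the additional spot `0` after `b + 1`
      -- steps.
      have hx' : b.succ + ((b : ℕ) + 1) • (-1) = 0 :=
        fin_add_nsmul_neg_one_eq (by simp)
      have := advance_eq (u := -1) (S := T.map (Fin.succEmb n)) (a := b.succ) (i := (b : ℕ) + 1)
        (by rw [hx']; exact h0 T) fun l hl => by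
          rw [fin_add_nsmul_neg_one_eq (x := (⟨b - l, by omega⟩ : Fin n).succ)
            (by simp; omega), hmem]
          exact h _ (Fin.le_def.2 (by simp))
      exact Fin.succ_ne_zero z ((Option.some_inj.1 h').symm.trans (this.trans hx'))
    · rw [parkSpot_true_eq_none_iff] at h
      -- Forward, `n - b` steps wrap around to the additional spot.
      have hx' : b.succ + (n - (b : ℕ)) • 1 = 0 :=
        fin_add_nsmul_one_eq (Or.inr (by simp; omega))
      have := advance_eq (u := 1) (S := T.map (Fin.succEmb n)) (a := b.succ) (i := n - (b : ℕ))
        (by rw [hx']; exact h0 T) fun l hl => by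
          rw [fin_add_nsmul_one_eq (x := (⟨b + l, by omega⟩ : Fin n).succ)
            (Or.inl (by simp; omega)), hmem]
          exact h _ (Fin.le_def.2 (by simp))
      exact Fin.succ_ne_zero z ((Option.some_inj.1 h').symm.trans (this.trans hx'))

/-- The number of pairs (preferences, coins) for which `k` cars park, weighted by the coins. -/
theorem expect_parkSpot_one (p : ℝ) {k : ℕ} (hk : k ≤ n + 1) :
    expect p (parkSpot (n := n)) k 1 =
      ((n : ℝ) + 1) ^ k * ((n + 1 - k) / (n + 1)) := by
  have h : extendZero (Fin.succEmb n) 1 = 1 - ind fun S => (0 : Fin (n + 1)) ∈ S := by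
    funext S
    rcases exists_map_eq_or (Fin.succEmb n) S with ⟨T, rfl⟩ | ⟨x, hx, hxe⟩
    · rw [extendZero_map, Pi.sub_apply, ind_neg]
      · simp
      · intro h
        obtain ⟨y, -, hy⟩ := Finset.mem_map.1 h
        exact Fin.succ_ne_zero y hy
    · rw [extendZero_of_mem _ _ hx hxe, Pi.sub_apply, ind_pos]
      · simp
      · by_cases h0 : x = 0
        · exact h0 ▸ hx
        · exact absurd ⟨x.pred h0, Fin.succ_pred x h0⟩ hxe
  rw [← expect_circle_extendZero, h, map_sub, expect_circle_one,
    expect_circle_mem p fin_exists_nsmul_one_eq (by simpa using hk)]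
  simp only [Fintype.card_fin]
  push_cast
  field_simp

/-- Here `x` is an end of the street, its complement being an interval. The cars park and leave `x`
free exactly when they park in the street without `x`, so two instances of `expect_parkSpot_one` are
subtracted. -/
lemma expect_parkSpot_mem_of_range (p : ℝ) {k : ℕ} (hk : k ≤ n + 1) (e : Fin n ↪o Fin (n + 1))
    (he : (Set.range e).OrdConnected) (x : Fin (n + 1)) (hx : ∀ y, y ∉ Set.range e ↔ y = x) :
    expect p (parkSpot (n := n + 1)) k (ind fun S => x ∈ S) =
      ((n : ℝ) + 2) ^ k * ((n + 2 - k) / (n + 2)) - ((n : ℝ) + 1) ^ k * ((n + 1 - k) / (n + 1)) := by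
  have h : (ind fun S => x ∈ S) = 1 - extendZero e.toEmbedding 1 := by
    funext S
    rcases exists_map_eq_or e.toEmbedding S with ⟨T, rfl⟩ | ⟨y, hy, hye⟩
    · rw [Pi.sub_apply, extendZero_map, ind_neg]
      · simp
      · intro h
        obtain ⟨y, -, hy⟩ := Finset.mem_map.1 h
        exact (hx x).2 rfl ⟨y, hy⟩
    · rw [Pi.sub_apply, extendZero_of_mem _ _ hy hye, ind_pos]
      · simp
      · exact (hx y).1 hye ▸ hy
  rw [h, map_sub, expect_parkSpot_extendZero p e he, expect_parkSpot_one p hk,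
    expect_parkSpot_one p (by omega)]
  push_cast
  ring

lemma expect_parkSpot_last_mem (p : ℝ) {k : ℕ} (hk : k ≤ n + 1) :
    expect p (parkSpot (n := n + 1)) k (ind fun S => Fin.last n ∈ S) =
      ((n : ℝ) + 2) ^ k * ((n + 2 - k) / (n + 2)) - ((n : ℝ) + 1) ^ k * ((n + 1 - k) / (n + 1)) := by
  have hr : ∀ y : Fin (n + 1), y ∉ Set.range (Fin.castSuccOrderEmb (n := n)) ↔ y = Fin.last n := by
    intro y
    constructor
    · intro h
      by_contra hy
      exact h ⟨y.castPred hy, Fin.castSucc_castPred y hy⟩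
    · rintro rfl ⟨z, hz⟩
      exact Fin.castSucc_ne_last z hz
  refine expect_parkSpot_mem_of_range p hk _ ⟨?_⟩ _ hr
  rintro _ _ _ ⟨y, rfl⟩ z hz
  by_contra h
  rw [hr] at h
  subst h
  exact absurd hz.2 (not_le.2 (Fin.castSucc_lt_last y))

lemma expect_parkSpot_zero_mem (p : ℝ) {k : ℕ} (hk : k ≤ n + 1) :
    expect p (parkSpot (n := n + 1)) k (ind fun S => (0 : Fin (n + 1)) ∈ S) =
      ((n : ℝ) + 2) ^ k * ((n + 2 - k) / (n + 2)) - ((n : ℝ) + 1) ^ k * ((n + 1 - k) / (n + 1)) := by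
  have hr : ∀ y : Fin (n + 1), y ∉ Set.range (Fin.succOrderEmb n) ↔ y = 0 := by
    intro y
    constructor
    · intro h
      by_contra hy
      exact h ⟨y.pred hy, Fin.succ_pred y hy⟩
    · rintro rfl ⟨z, hz⟩
      exact Fin.succ_ne_zero z hz
  refine expect_parkSpot_mem_of_range p hk _ ⟨?_⟩ _ hr
  rintro _ ⟨x, rfl⟩ _ - z hz
  by_contra h
  rw [hr] at h
  subst h
  exact absurd hz.1 (not_le.2 (Fin.succ_pos x))

/-- A run next to an end of the street is a run next to the additional spot of the circle. -/
lemma expect_parkSpot_run_le {p : ℝ} (hp : p ∈ Set.Icc (0 : ℝ) 1) (k : ℕ) (P : Fin n → Prop)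
    (v : Fin (n + 1)) (d : ℕ)
    (hv : ∀ i : ℕ, 1 ≤ i → i ≤ d → ∃ y, P y ∧ y.succ = i • v) :
    expect p parkSpot k (ind fun S => ∀ y, P y → y ∈ S) ≤
      expect p (circleSpot (1 : Fin (n + 1))) k
        (ind fun S => (0 : Fin (n + 1)) ∉ S ∧ ∀ i : ℕ, 1 ≤ i → i ≤ d → i • v ∈ S) := by
  rw [← expect_circle_extendZero]
  refine expect_mono hp _ _ fun S => ?_
  rcases exists_map_eq_or (Fin.succEmb n) S with ⟨T, rfl⟩ | ⟨x, hx, hxe⟩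
  · rw [extendZero_map]
    by_cases h : ∀ y, P y → y ∈ T
    · rw [ind_pos h, ind_pos]
      refine ⟨fun h => ?_, fun i hi hid => ?_⟩
      · obtain ⟨y, -, hy⟩ := Finset.mem_map.1 h
        exact Fin.succ_ne_zero y hy
      · obtain ⟨y, hy, hyv⟩ := hv i hi hid
        exact Finset.mem_map.2 ⟨y, h y hy, hyv⟩
    · rw [ind_neg h]
      exact ind_nonneg _ _
  · rw [extendZero_of_mem _ _ hx hxe]
    exact ind_nonneg _ _

/-- The sum is the mean length of the run at the right end. Seen from the additional spot, the
suffix from `j` is a run of `n - j` spots in direction `-1`. -/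
lemma sum_expect_parkSpot_suffix_le {p : ℝ} (hp : p ∈ Set.Icc (0 : ℝ) 1) {k : ℕ}
    (hk : k ≤ n + 1) :
    ∑ j : Fin n, expect p parkSpot k (ind fun S => ∀ y, j ≤ y → y ∈ S) ≤
      ((n : ℝ) + 1) ^ k * (k / (n + 1)) := by
  refine (Finset.sum_le_sum fun (j : Fin n) _ =>
    expect_parkSpot_run_le hp k _ (-1) (n - (j : ℕ)) ?_).trans
    ((sum_expect_run_le hp (1 : Fin (n + 1)) (-1) k (fun j : Fin n => n - (j : ℕ)) ?_ ?_).trans ?_)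
  · intro i hi hid
    refine ⟨⟨n - i, by omega⟩, Fin.le_def.2 (by simp; omega), ?_⟩
    rw [smul_neg, eq_neg_iff_add_eq_zero]
    exact fin_add_nsmul_one_eq (Or.inr (by simp; omega))
  · intro i j hij
    exact Fin.ext (by simp at hij; omega)
  · intro j
    omega
  · rw [expect_circle_mem p fin_exists_nsmul_one_eq (by simpa using hk), Fintype.card_fin, mul_div]
    push_cast
    rfl

lemma sum_expect_parkSpot_prefix_le {p : ℝ} (hp : p ∈ Set.Icc (0 : ℝ) 1) {k : ℕ}
    (hk : k ≤ n + 1) :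
    ∑ j : Fin n, expect p parkSpot k (ind fun S => ∀ y, y ≤ j → y ∈ S) ≤
      ((n : ℝ) + 1) ^ k * (k / (n + 1)) := by
  refine (Finset.sum_le_sum fun (j : Fin n) _ =>
    expect_parkSpot_run_le hp k _ 1 ((j : ℕ) + 1) ?_).trans
    ((sum_expect_run_le hp (1 : Fin (n + 1)) 1 k (fun j : Fin n => (j : ℕ) + 1) ?_ ?_).trans ?_)
  · intro i hi hid
    refine ⟨⟨i - 1, by omega⟩, Fin.le_def.2 (by simp; omega), ?_⟩
    have := fin_add_nsmul_one_eq (n := n) (a := 0) (x := (⟨i - 1, by omega⟩ : Fin n).succ) (i := i)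
      (Or.inl (by simp; omega))
    rw [← this, zero_add]
  · intro i j hij
    exact Fin.ext (by simpa using hij)
  · intro j
    omega
  · rw [expect_circle_mem p fin_exists_nsmul_one_eq (by simpa using hk), Fintype.card_fin, mul_div]
    push_cast
    rfl

end Line

/-! ### The conditional law of the last preference in terms of defects -/

section Bridge

variable {n : ℕ}

lemma sum_fin_succ_fun {α : Type*} [Fintype α] {m : ℕ} (φ : (Fin (m + 1) → α) → ℝ) :
    ∑ a, φ a = ∑ a : Fin m → α, ∑ x, φ (Fin.snoc (α := fun _ => α) a x) := by
  rw [← (Fin.snocEquiv fun _ => α).sum_comp, Fintype.sum_prod_type_right]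
  rfl

theorem sum_occupied_eq_expect (p : ℝ) (m : ℕ) (g : Finset (Fin n) → ℝ) :
    ∑ a : Fin m → Fin n, ∑ b : Fin m → Bool,
      (∏ i, coinWeight p (b i)) * (occupied m a b).elim 0 g = expect p parkSpot m g := by
  induction m generalizing g with
  | zero => simp [occupied, expect_zero]
  | succ m ih =>
    rw [expect_succ, ← ih, sum_fin_succ_fun]
    refine Finset.sum_congr rfl fun a _ => ?_
    simp_rw [sum_fin_succ_fun (α := Bool)]
    rw [Finset.sum_comm]
    refine Finset.sum_congr rfl fun b _ => ?_
    simp only [Fin.prod_univ_castSucc, Fin.snoc_castSucc, Fin.snoc_last, occupied, Fin.init_snoc]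
    cases occupied m a b with
    | none => simp
    | some S =>
      simp only [Option.bind_some, Option.elim_some, step_apply, Finset.mul_sum, mul_assoc]
      refine Finset.sum_congr rfl fun x _ => Finset.sum_congr rfl fun c _ => ?_
      cases parkSpot S x c <;> rfl

lemma prob_allPark (p : ℝ) (m : ℕ) :
    prob p m n (fun a b => AllPark a b) = 1 / (n : ℝ) ^ m * expect p (parkSpot (n := n)) m 1 := by
  rw [← sum_occupied_eq_expect, prob, Finset.mul_sum]
  refine Finset.sum_congr rfl fun a _ => ?_
  rw [Finset.mul_sum]
  refine Finset.sum_congr rfl fun b _ => ?_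
  unfold AllPark
  cases occupied m a b <;> simp [coinWeight]

/-- The probability that a car with preference `j` can park. -/
noncomputable def parkProb (p : ℝ) (j : Fin n) (S : Finset (Fin n)) : ℝ :=
  ∑ c, coinWeight p c * (parkSpot S j c).elim 0 fun _ => 1

/-- Fixing the last preference leaves a sum over the first `k` cars and the last coin. The
normalisation is the one of `prob_allPark` for `k + 1` cars and cancels in `Q`. -/
lemma prob_lastPref_allPark (p : ℝ) (k : ℕ) (j : Fin n) :
    prob p (k + 1) n (fun a b => LastPref j a ∧ AllPark a b) =
      1 / (n : ℝ) ^ (k + 1) * expect p parkSpot k (parkProb p j) := by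
  have hlast : ∀ (a : Fin k → Fin n) (x : Fin n),
      LastPref j (Fin.snoc (α := fun _ => Fin n) a x) ↔ x = j := by
    intro a x
    constructor
    · rintro ⟨i, hi, h⟩
      obtain rfl : i = Fin.last k := Fin.ext (by simp; omega)
      simpa using h
    · rintro rfl
      exact ⟨Fin.last k, by simp, by simp⟩
  rw [← sum_occupied_eq_expect, prob, sum_fin_succ_fun, Finset.mul_sum]
  refine Finset.sum_congr rfl fun a _ => ?_
  simp_rw [sum_fin_succ_fun (α := Bool)]
  rw [Finset.sum_eq_single j (fun x _ hx => Finset.sum_eq_zero fun b _ =>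
    Finset.sum_eq_zero fun c _ => if_neg fun h => hx ((hlast a x).1 h.1)) (by simp),
    Finset.mul_sum]
  refine Finset.sum_congr rfl fun b _ => ?_
  have hE : ∀ x : Bool, (LastPref j (Fin.snoc (α := fun _ => Fin n) a j) ∧
      AllPark (Fin.snoc (α := fun _ => Fin n) a j) (Fin.snoc (α := fun _ => Bool) b x)) ↔
      ((occupied k a b).bind fun S => (parkSpot S j x).map fun y => insert y S).isSome = true := by
    intro x
    rw [and_iff_right ((hlast a j).2 rfl), AllPark, occupied]
    simp only [Fin.snoc_last, Fin.init_snoc]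
  refine (Finset.sum_congr rfl fun x _ =>
    @if_congr _ _ _ (Classical.propDecidable _) _ _ _ _ _ (hE x) rfl rfl).trans ?_
  simp only [Fin.prod_univ_castSucc, Fin.snoc_castSucc, Fin.snoc_last]
  cases occupied k a b with
  | none => simp
  | some S =>
    simp only [Option.bind_some, Option.elim_some, Option.isSome_map, parkProb, Finset.mul_sum]
    refine Finset.sum_congr rfl fun x _ => ?_
    cases parkSpot S j x <;> simp [coinWeight]

lemma parkProb_eq (p : ℝ) (j : Fin n) :
    parkProb p j = 1 - (p • (ind fun S => ∀ y, j ≤ y → y ∈ S) +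
      (1 - p) • ind fun S => ∀ y, y ≤ j → y ∈ S) := by
  have h : ∀ (S : Finset (Fin n)) c, ((parkSpot S j c).elim 0 fun _ => 1 : ℝ) =
      1 - ind (fun S => parkSpot S j c = none) S := by
    intro S c
    cases hc : parkSpot S j c <;> simp [ind, hc]
  funext S
  simp only [parkProb, h, Fintype.sum_bool, parkSpot_true_eq_none_iff, parkSpot_false_eq_none_iff]
  simp [coinWeight]
  ring

/-- The weighted number of ways in which `k` cars park and a further car with preference `j`
does not. -/
noncomputable def defect (p : ℝ) (k : ℕ) (j : Fin n) : ℝ :=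
  p * expect p parkSpot k (ind fun S => ∀ y, j ≤ y → y ∈ S) +
    (1 - p) * expect p parkSpot k (ind fun S => ∀ y, y ≤ j → y ∈ S)

lemma expect_parkProb (p : ℝ) (k : ℕ) (j : Fin n) :
    expect p parkSpot k (parkProb p j) = expect p (parkSpot (n := n)) k 1 - defect p k j := by
  rw [parkProb_eq, map_sub, map_add, map_smul, map_smul]
  rfl

lemma defect_nonneg {p : ℝ} (hp : p ∈ Set.Icc (0 : ℝ) 1) (k : ℕ) (j : Fin n) :
    0 ≤ defect p k j := by
  have h : ∀ P : Finset (Fin n) → Prop, 0 ≤ expect p parkSpot k (ind P) := fun P => by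
    simpa using expect_mono hp parkSpot k (ind_nonneg P)
  exact add_nonneg (mul_nonneg hp.1 (h _)) (mul_nonneg (sub_nonneg.2 hp.2) (h _))

lemma sum_defect_le {p : ℝ} (hp : p ∈ Set.Icc (0 : ℝ) 1) {k : ℕ} (hk : k ≤ n + 1) :
    ∑ j : Fin n, defect p k j ≤ ((n : ℝ) + 1) ^ k * (k / (n + 1)) := by
  simp only [defect]
  rw [Finset.sum_add_distrib, ← Finset.mul_sum, ← Finset.mul_sum]
  have h1 := mul_le_mul_of_nonneg_left (sum_expect_parkSpot_suffix_le hp hk) hp.1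
  have h2 := mul_le_mul_of_nonneg_left (sum_expect_parkSpot_prefix_le hp hk) (sub_nonneg.2 hp.2)
  linarith

/-- Keep the heads term at the last spot and the tails term at the first one. Both ends are occupied
with the same weight, and `p + (1 - p) = 1`. Taking the ends together makes the bound uniform in
`p`; a kept term vanishes when its coin weight is zero. -/
lemma le_defect_last_add_defect_zero {p : ℝ} (hp : p ∈ Set.Icc (0 : ℝ) 1) {k : ℕ}
    (hk : k ≤ n + 1) :
    ((n : ℝ) + 2) ^ k * ((n + 2 - k) / (n + 2)) - ((n : ℝ) + 1) ^ k * ((n + 1 - k) / (n + 1)) ≤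
      defect p k (Fin.last n) + defect p k (0 : Fin (n + 1)) := by
  have h : ∀ P : Finset (Fin (n + 1)) → Prop, 0 ≤ expect p parkSpot k (ind P) := fun P => by
    simpa using expect_mono hp parkSpot k (ind_nonneg P)
  have h1 : expect p parkSpot k (ind fun S => ∀ y, Fin.last n ≤ y → y ∈ S) =
      expect p parkSpot k (ind fun S => Fin.last n ∈ S) := by
    simp [Fin.last_le_iff]
  have h2 : expect p parkSpot k (ind fun S => ∀ y : Fin (n + 1), y ≤ 0 → y ∈ S) =
      expect p parkSpot k (ind fun S => (0 : Fin (n + 1)) ∈ S) := by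
    simp
  rw [defect, defect, h1, h2, expect_parkSpot_last_mem p hk, expect_parkSpot_zero_mem p hk]
  have h3 := mul_nonneg (sub_nonneg.2 hp.2)
    (h fun S => ∀ y, y ≤ Fin.last n → y ∈ S)
  have h4 := mul_nonneg hp.1 (h fun S => ∀ y : Fin (n + 1), 0 ≤ y → y ∈ S)
  linarith

lemma expect_parkSpot_succ_one (p : ℝ) (k : ℕ) :
    expect p (parkSpot (n := n)) (k + 1) 1 = n * expect p (parkSpot (n := n)) k 1 - ∑ j : Fin n, defect p k j := by
  have h : step p (parkSpot (n := n)) 1 = ∑ j, parkProb p j := by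
    funext S
    rw [Finset.sum_apply]
    rfl
  rw [expect_succ, h, map_sum]
  simp [expect_parkProb]

lemma Q_succ_eq (hn : n ≠ 0) (p : ℝ) (k : ℕ) (j : Fin n) :
    Q (k + 1) n p j = (expect p (parkSpot (n := n)) k 1 - defect p k j) /
      (n * expect p (parkSpot (n := n)) k 1 - ∑ j : Fin n, defect p k j) := by
  have : (1 / (n : ℝ) ^ (k + 1)) ≠ 0 := by positivity
  rw [Q, prob_lastPref_allPark, prob_allPark, mul_div_mul_left _ _ this, expect_parkProb,
    expect_parkSpot_succ_one]

end Bridge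

/-! ### Bounds for the total variation distance -/

section Estimates

/-- The total variation distance to the uniform distribution of the normalisation of `W - d`. -/
lemma tv_uni_eq {n : ℕ} (hn : n ≠ 0) (d : Fin n → ℝ) {W : ℝ} (hW : ∑ j, d j < n * W) :
    tv (fun j => (W - d j) / (n * W - ∑ j, d j)) (Uni n) =
      (∑ j, |∑ j, d j - n * d j|) / (2 * n * (n * W - ∑ j, d j)) := by
  have hpos : 0 < n * W - ∑ j, d j := sub_pos.2 hW
  have hne := hpos.ne'
  have hn' : (0 : ℝ) < n := by positivity
  rw [tv, Finset.sum_div, Finset.mul_sum]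
  refine Finset.sum_congr rfl fun j _ => ?_
  have : (W - d j) / (n * W - ∑ j, d j) - Uni n j =
      (∑ j, d j - n * d j) / (n * (n * W - ∑ j, d j)) := by
    rw [Uni]
    rw [div_sub_div _ _ hne hn'.ne', div_eq_div_iff (by positivity) (by positivity)]
    ring
  rw [this, abs_div, abs_of_pos (mul_pos hn' hpos)]
  field_simp

lemma sum_abs_le {n : ℕ} (d : Fin n → ℝ) (hd : ∀ j, 0 ≤ d j) :
    ∑ j, |∑ j, d j - n * d j| ≤ 2 * n * ∑ j, d j := by
  calc ∑ j, |∑ j, d j - n * d j| ≤ ∑ j, (∑ j, d j + n * d j) := by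
        refine Finset.sum_le_sum fun j _ => ?_
        have h1 := Finset.sum_nonneg fun j (_ : j ∈ Finset.univ) => hd j
        have h2 := mul_nonneg n.cast_nonneg (hd j)
        rw [abs_le]
        constructor <;> linarith
    _ = 2 * n * ∑ j, d j := by
        rw [Finset.sum_add_distrib, ← Finset.mul_sum]
        simp
        ring

lemma le_sum_abs {n : ℕ} (d : Fin n → ℝ) {i j : Fin n} (hij : i ≠ j) :
    n * (d i + d j) - 2 * ∑ j, d j ≤ ∑ j, |∑ j, d j - n * d j| := by
  have h := Finset.sum_le_sum_of_subset_of_nonneg (Finset.subset_univ {i, j})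
    fun l _ _ => abs_nonneg (∑ j, d j - n * d l)
  rw [Finset.sum_pair hij] at h
  have h1 := neg_abs_le (∑ j, d j - n * d i)
  have h2 := neg_abs_le (∑ j, d j - n * d j)
  linarith

lemma tv_Q_uni_le {n k : ℕ} (hkn : k < n) {p : ℝ} (hp : p ∈ Set.Icc (0 : ℝ) 1) :
    tv (Q (k + 1) n p) (Uni n) ≤ 1 / ((n : ℝ) - k) := by
  have hn : n ≠ 0 := by omega
  have hk : (k : ℝ) < n := by exact_mod_cast hkn
  set D := ∑ j : Fin n, defect p k j with hD
  set W := expect p (parkSpot (n := n)) k 1 with hW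
  have hDle : D ≤ ((n : ℝ) + 1) ^ k * (k / (n + 1)) := sum_defect_le hp (by omega)
  have hWeq : W = ((n : ℝ) + 1) ^ k * ((n + 1 - k) / (n + 1)) := expect_parkSpot_one p (by omega)
  have hX : (0 : ℝ) < ((n : ℝ) + 1) ^ k := by positivity
  -- This rests on `n * (n + 1 - k) - k = (n + 1) * (n - k)`.
  have hle : ((n : ℝ) + 1) ^ k * (n - k) ≤ n * W - D := by
    have : n * W - ((n : ℝ) + 1) ^ k * (k / (n + 1)) = ((n : ℝ) + 1) ^ k * (n - k) := by
      rw [hWeq]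
      field_simp
      ring
    linarith
  have hpos : 0 < n * W - D := (mul_pos hX (sub_pos.2 hk)).trans_le hle
  have hQ : Q (k + 1) n p = fun j => (W - defect p k j) / (n * W - D) :=
    funext fun j => Q_succ_eq hn p k j
  rw [hQ, tv_uni_eq hn _ (sub_pos.1 hpos), ← hD]
  have hn' : (0 : ℝ) < n := by positivity
  rw [div_le_div_iff₀ (by positivity) (sub_pos.2 hk)]
  have hDX : D ≤ ((n : ℝ) + 1) ^ k := by
    refine hDle.trans (mul_le_of_le_one_right hX.le ?_)
    rw [div_le_one (by positivity)]
    linarith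
  calc (∑ j : Fin n, |D - n * defect p k j|) * ((n : ℝ) - k)
      ≤ (2 * n * D) * ((n : ℝ) - k) :=
        mul_le_mul_of_nonneg_right (sum_abs_le _ (defect_nonneg hp k)) (sub_pos.2 hk).le
    _ ≤ (2 * n * ((n : ℝ) + 1) ^ k) * (n - k) := by
        gcongr
    _ = 2 * n * (((n : ℝ) + 1) ^ k * (n - k)) := by ring
    _ ≤ 1 * (2 * n * (n * W - D)) := by
        rw [one_mul]
        gcongr

lemma le_tv_Q_uni {n k : ℕ} (hkn : k < n) (hn1 : 1 < n) {p : ℝ} (hp : p ∈ Set.Icc (0 : ℝ) 1) :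
    (1 / (n : ℝ)) * ((1 - ((n : ℝ) / (n + 1)) ^ k) / 2 - 1 / (n - k)) ≤
      tv (Q (k + 1) n p) (Uni n) := by
  have hn : n ≠ 0 := by omega
  have hk : (k : ℝ) < n := by exact_mod_cast hkn
  have hk' : (0 : ℝ) < n - k := sub_pos.2 hk
  set D := ∑ j : Fin n, defect p k j with hD
  set W := expect p (parkSpot (n := n)) k 1 with hW
  set X : ℝ := ((n : ℝ) + 1) ^ k with hXdef
  have hn' : (0 : ℝ) < n := by positivity
  have hDle : D ≤ X * (k / (n + 1)) := sum_defect_le hp (by omega)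
  have hWeq : W = X * ((n + 1 - k) / (n + 1)) := expect_parkSpot_one p (by omega)
  have hX : (0 : ℝ) < X := by positivity
  have hD0 : 0 ≤ D := Finset.sum_nonneg fun j _ => defect_nonneg hp k j
  have hWpos : 0 < W := by
    rw [hWeq]
    have : (0 : ℝ) < n + 1 - k := by linarith
    positivity
  have hpos : 0 < n * W - D := by
    have : n * W - X * (k / (n + 1)) = X * (n - k) := by
      rw [hWeq]
      field_simp
      ring
    have := mul_pos hX hk'
    linarith
  have hQ : Q (k + 1) n p = fun j => (W - defect p k j) / (n * W - D) :=
    funext fun j => Q_succ_eq hn p k j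
  rw [hQ, tv_uni_eq hn _ (sub_pos.1 hpos), ← hD]
  -- After clearing denominators the slack is a multiple of `(n - k) ^ 2 + n`.
  have hDW : D ≤ W * (n / (n - k)) := by
    refine hDle.trans ?_
    rw [hWeq, mul_assoc]
    refine mul_le_mul_of_nonneg_left ?_ hX.le
    rw [div_mul_div_comm, div_le_div_iff₀ (by positivity) (by positivity)]
    nlinarith [mul_nonneg (by positivity : (0 : ℝ) ≤ n + 1)
      (add_nonneg (sq_nonneg ((n : ℝ) - k)) hn'.le)]
  -- The witnesses are the two ends, distinct because `1 < n`.
  obtain ⟨i, j, hij, hB⟩ : ∃ i j : Fin n, i ≠ j ∧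
      W * (1 - ((n : ℝ) / (n + 1)) ^ k) ≤ defect p k i + defect p k j := by
    obtain ⟨l, rfl⟩ : ∃ l, n = l + 1 := ⟨n - 1, by omega⟩
    refine ⟨Fin.last l, 0, ?_, le_trans ?_ (le_defect_last_add_defect_zero hp (by omega))⟩
    · rw [Ne, Fin.ext_iff]
      simp
      omega
    · rw [hWeq, div_pow, hXdef]
      push_cast at *
      have e1 : (l : ℝ) + 1 + 1 = l + 2 := by ring
      rw [e1] at *
      -- The fraction `1 - k / x` increases with `x`, so the subtracted term may take the larger
      -- factor and `W` factors out.
      have h3 : ((l : ℝ) + 1 - k) / (l + 1) ≤ (l + 2 - k) / (l + 2) := by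
        rw [div_le_div_iff₀ (by positivity) (by positivity)]
        nlinarith [(k.cast_nonneg : (0 : ℝ) ≤ k)]
      have h4 := mul_le_mul_of_nonneg_left h3 (by positivity : (0 : ℝ) ≤ ((l : ℝ) + 1) ^ k)
      have h5 : ((l : ℝ) + 2) ^ k * ((l + 2 - k) / (l + 2)) *
          (1 - ((l : ℝ) + 1) ^ k / ((l : ℝ) + 2) ^ k) =
          ((l : ℝ) + 2) ^ k * ((l + 2 - k) / (l + 2)) -
            ((l : ℝ) + 1) ^ k * ((l + 2 - k) / (l + 2)) := by
        field_simp
      rw [h5]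
      linarith
  have hsum := le_sum_abs (fun j => defect p k j) hij
  rw [← hD] at hsum
  set β : ℝ := 1 - ((n : ℝ) / (n + 1)) ^ k
  have hnum : n * W * (β - 2 / (n - k)) ≤ ∑ j : Fin n, |D - n * defect p k j| := by
    refine le_trans ?_ hsum
    have h1 := mul_le_mul_of_nonneg_left hB hn'.le
    have h2 : n * W * (β - 2 / (n - k)) = n * (W * β) - 2 * (W * (n / (n - k))) := by
      field_simp
    rw [h2]
    linarith
  have hnum0 : 0 ≤ ∑ j : Fin n, |D - n * defect p k j| := Finset.sum_nonneg fun _ _ => abs_nonneg _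
  calc (1 / (n : ℝ)) * (β / 2 - 1 / (n - k)) = n * W * (β - 2 / (n - k)) / (2 * n * (n * W)) := by
        field_simp
    _ ≤ (∑ j : Fin n, |D - n * defect p k j|) / (2 * n * (n * W)) := by gcongr
    -- Subtracting `D ≥ 0` only shrinks the denominator, and the numerator is nonnegative.
    _ ≤ (∑ j, |D - n * defect p k j|) / (2 * n * (n * W - D)) := by
        gcongr
        linarith

end Estimates

end ProbParking

/-! ### Asymptotics for `m` close to `c * n` -/

open Filter Topology in
theorem proposition3p4 (c : ℝ) (hc0 : 0 < c) (hc1 : c < 1)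
    (m : ℕ → ℕ) (hm : ∀ n : ℕ, |(m n : ℝ) - c * (n : ℝ)| < 1)
    (p : ℝ) (hp : p ∈ Set.Icc (0 : ℝ) 1) :
    Asymptotics.IsTheta Filter.atTop
      (fun n : ℕ => ProbParking.tv (ProbParking.Q (m n) n p) (ProbParking.Uni n))
      (fun n : ℕ => 1 / (n : ℝ)) := by
  have htv : ∀ {n : ℕ} (P R : Fin n → ℝ), ‖ProbParking.tv P R‖ = ProbParking.tv P R := by
    intro n P R
    exact Real.norm_of_nonneg
      (mul_nonneg (by norm_num) (Finset.sum_nonneg fun _ _ => abs_nonneg _))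
  have hc1' : 0 < 1 - c := sub_pos.2 hc1
  -- This yields `c * n ≥ 6 + 2 * c`, enough for `k > c * n - 2` to exceed `c / 2 * (n + 1)`.
  have hlarge : ∀ᶠ n : ℕ in atTop, 6 / c + 2 ≤ n :=
    tendsto_natCast_atTop_atTop.eventually_ge_atTop _
  have hbasic : ∀ n : ℕ, 6 / c + 2 ≤ n → ∃ k, m n = k + 1 ∧ k < n ∧ 1 < n ∧
      (1 - c) * n ≤ n - k ∧ c / 2 * (n + 1) ≤ k := by
    intro n hn
    have hm1 := abs_lt.1 (hm n)
    have h6 : 6 + 2 * c ≤ c * n := by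
      have := mul_le_mul_of_nonneg_left hn hc0.le
      rwa [mul_add, mul_div_cancel₀ _ hc0.ne', mul_comm c 2] at this
    have hn2 : (2 : ℝ) < n := by
      have : 0 < 6 / c := by positivity
      linarith
    have hmpos : 0 < m n := by
      have : (0 : ℝ) < m n := by linarith
      exact_mod_cast this
    obtain ⟨k, hk⟩ : ∃ k, m n = k + 1 := ⟨m n - 1, by omega⟩
    have hk' : (m n : ℝ) = k + 1 := by rw [hk]; push_cast; rfl
    have h1 : (1 - c) * n ≤ n - k := by linarith
    refine ⟨k, hk, ?_, ?_, h1, by linarith⟩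
    · have : (0 : ℝ) < (1 - c) * n := by positivity
      have : (k : ℝ) < n := by linarith
      exact_mod_cast this
    · have : (1 : ℝ) < n := by linarith
      exact_mod_cast this
  refine ⟨Asymptotics.IsBigO.of_bound (1 / (1 - c)) ?_, ?_⟩
  · filter_upwards [hlarge] with n hn
    obtain ⟨k, hk, hkn, hn1, h1, -⟩ := hbasic n hn
    have hn0 : (0 : ℝ) < n := by exact_mod_cast (by omega : 0 < n)
    rw [htv, Real.norm_of_nonneg (by positivity), hk]
    refine (ProbParking.tv_Q_uni_le hkn hp).trans ?_
    rw [div_mul_div_comm, one_mul]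
    exact one_div_le_one_div_of_le (by positivity) h1
  · have hβ : 0 < 1 - Real.exp (-(c / 2)) := by
      rw [sub_pos, Real.exp_lt_one_iff]
      linarith
    set β : ℝ := 1 - Real.exp (-(c / 2)) with hβdef
    -- The threshold makes `1 / (n - k) ≤ β / 4`, so half of the main term `β / 2` survives.
    have hlarge' : ∀ᶠ n : ℕ in atTop, 4 / (β * (1 - c)) ≤ n :=
      tendsto_natCast_atTop_atTop.eventually_ge_atTop _
    refine Asymptotics.IsBigO.of_bound (4 / β) ?_
    filter_upwards [hlarge, hlarge'] with n hn hn4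
    obtain ⟨k, hk, hkn, hn1, h1, h2⟩ := hbasic n hn
    have hn0 : (0 : ℝ) < n := by exact_mod_cast (by omega : 0 < n)
    rw [htv, Real.norm_of_nonneg (by positivity), hk]
    have hpow : ((n : ℝ) / (n + 1)) ^ k ≤ Real.exp (-(c / 2)) := by
      -- Here `n / (n + 1) = 1 - 1 / (n + 1)`; the exponent `k ≥ c / 2 * (n + 1)` then gives `exp
      -- (-(c / 2))`.
      have h3 : (n : ℝ) / (n + 1) ≤ Real.exp (-(1 / (n + 1))) := by
        have := Real.add_one_le_exp (-(1 / ((n : ℝ) + 1)))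
        refine le_trans (le_of_eq ?_) this
        field_simp
        ring
      refine (pow_le_pow_left₀ (by positivity) h3 k).trans ?_
      rw [← Real.exp_nat_mul, Real.exp_le_exp, mul_neg, neg_le_neg_iff, mul_one_div,
        le_div_iff₀ (by positivity)]
      exact h2
    have hsmall : 1 / ((n : ℝ) - k) ≤ β / 4 := by
      refine (one_div_le_one_div_of_le (by positivity) h1).trans ?_
      rw [div_le_iff₀ (by positivity)] at hn4
      rw [div_le_div_iff₀ (by positivity) (by norm_num)]
      linarith
    have hlow : 1 / (n : ℝ) * (β / 4) ≤ ProbParking.tv (ProbParking.Q (k + 1) n p)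
        (ProbParking.Uni n) := by
      refine le_trans ?_ (ProbParking.le_tv_Q_uni hkn hn1 hp)
      refine mul_le_mul_of_nonneg_left ?_ (by positivity)
      linarith
    calc 1 / (n : ℝ) = 4 / β * (1 / (n : ℝ) * (β / 4)) := by field_simp
      _ ≤ _ := mul_le_mul_of_nonneg_left hlow (by positivity)
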